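/- Let $G=(V,E)$ be a finite $3$-uniform hypergraph with at least one edge: $V$ is a finite set and $E$ is a nonempty finite multiset of $3$-element subsets of $V$. For each edge $e=\{u,v,w\}$ put either the state $|W\rangle_e=|100\rangle+|010\rangle+|001\rangle$ or the state $|\mathrm{GHZ}_2(3)\rangle_e=|000\rangle+|111\rangle$ on three qubits labelled $(e,u),(e,v),(e,w)$, and let $$|W\rangle_G=\bigotimes_{e\in E}|W\rangle_e,\qquad |\mathrm{GHZ}_2(3)\rangle_G=\bigotimes_{e\in E}|\mathrm{GHZ}_2(3)\rangle_e ,$$ regarded as $|V|$-party tensors in which party $v\in V$ holds the space $\mathcal H_v=\bigotimes_{e\ni v}\mathbb C^2$. For tensors $\phi\in\bigotimes_{v\in V}\mathcal H_v$ and $\psi\in\bigotimes_{v\in V}\mathcal H'_v$ with finite-dimensional complex local spaces, write $\phi\ge\psi$ ($\phi$ restricts to $\psi$) if there are linear maps $M_v:\mathcal H_v\to\mathcal H'_v$ with $\bigl(\bigotimes_{v}M_v\bigr)\phi=\psi$, and write $\phi\gtrsim\psi$ ($\phi$ asymptotically restricts to $\psi$) if there is $f:\mathbb N\to\mathbb N$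 with $f(n)=o(n)$ such that $\phi^{\otimes(n+f(n))}\ge\psi^{\otimes n}$ for all $n\in\mathbb N$, where in the powers all copies belonging to the same $v$ are grouped into one party. Then $|W\rangle_G\gtrsim|\mathrm{GHZ}_2(3)\rangle_G$ does not hold, and in particular $|W\rangle_G\ge|\mathrm{GHZ}_2(3)\rangle_G$ does not hold. -/

import Mathlib

open Filter Asymptotics
open scoped TensorProduct

noncomputable section

/-! ### Multiparty states (tensors), restriction and asymptotic restriction -/

/-- (Not necessarily normalized) states shared by the parties `p : P`, where party `p` holds the
Hilbert space `ℂ^(ι p)`; that is, elements of the tensor product of the spaces `ι p → ℂ`. -/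
abbrev PartyState {P : Type*} (ι : P → Type*) : Type _ := ⨂[ℂ] p, (ι p → ℂ)

/-- The computational basis vector `|i⟩` of `ℂ^κ`. -/
def ket {κ : Type*} (i : κ) : κ → ℂ :=
  open scoped Classical in Pi.single i 1

/-- The coefficients of a state in the product basis `⨂ p, |x p⟩`, as a linear equivalence. -/
def PartyState.coords {P : Type*} {ι : P → Type*} [Finite P] [∀ p, Finite (ι p)] :
    PartyState ι ≃ₗ[ℂ] ((∀ p, ι p) → ℂ) :=
  (Basis.piTensorProduct fun p => Pi.basisFun ℂ (ι p)).repr ≪≫ₗ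
    Finsupp.linearEquivFunOnFinite ℂ ℂ (∀ p, ι p)

/-- The restriction preorder `φ ≥ ψ`: there are linear maps `M p`, one for each party, with
`(⨂ p, M p) φ = ψ`. -/
def Restricts {P : Type*} {ι κ : P → Type*} (φ : PartyState ι) (ψ : PartyState κ) : Prop :=
  ∃ M : ∀ p, (ι p → ℂ) →ₗ[ℂ] (κ p → ℂ), PiTensorProduct.map M φ = ψ

/-- The `n`-th power `φ^{⊗ n}` as a state of the same parties (Kronecker power): party `p` holds
the `p`-th systems of all `n` copies, i.e. `(ℂ^(ι p))^{⊗ n} = ℂ^(Fin n → ι p)`. -/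
def PartyState.power {P : Type*} {ι : P → Type*} [Finite P] [∀ p, Finite (ι p)]
    (φ : PartyState ι) (n : ℕ) : PartyState fun p => Fin n → ι p :=
  coords.symm fun x => ∏ a : Fin n, coords φ fun p => x p a

/-- Asymptotic restriction `φ ≳ ψ`: for some `f` with `f n = o(n)`, `φ^{⊗ (n + f n)}` restricts to
`ψ^{⊗ n}` for every `n`. -/
def AsymptoticallyRestricts {P : Type*} {ι κ : P → Type*} [Finite P] [∀ p, Finite (ι p)]
    [∀ p, Finite (κ p)] (φ : PartyState ι) (ψ : PartyState κ) : Prop :=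
  ∃ f : ℕ → ℕ, ((fun n => (f n : ℝ)) =o[atTop] fun n => (n : ℝ)) ∧
    ∀ n, Restricts (φ.power (n + f n)) (ψ.power n)

/-- The level-`r` GHZ state `∑ i, |i⟩ ⊗ ⋯ ⊗ |i⟩` on the parties `P`. -/
def ghzState (P : Type*) (r : ℕ) : PartyState fun _ : P => Fin r :=
  ∑ i : Fin r, ⨂ₜ[ℂ] _ : P, ket i

/-- The W state `|10⋯0⟩ + |01⋯0⟩ + ⋯ + |0⋯01⟩` on the parties `P`. -/
def wState (P : Type*) [Fintype P] : PartyState fun _ : P => Fin 2 :=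
  open scoped Classical in ∑ q : P, ⨂ₜ[ℂ] p : P, ket (if p = q then 1 else 0)

/-! ### Hypergraphs and entanglement structures -/

/-- A hypergraph with vertex set `V` and edges labelled by `E`; each edge is a finite set of
(distinct) vertices, and several edges may have the same vertices. -/
structure MultiHypergraph (V E : Type*) where
  verts : E → Finset V

namespace MultiHypergraph

variable {V E : Type*} (G : MultiHypergraph V E)

/-- Every edge consists of exactly `k` vertices. -/
def IsUniform (k : ℕ) : Prop := ∀ e, (G.verts e).card = k

/-- If `H_{e,v} = ℂ^(ι e v)`, this is the index set of the product basis of the vertex space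
`H_v = ⨂_{e ∋ v} H_{e,v}`. -/
abbrev VertexIndex (ι : ∀ e, G.verts e → Type*) (v : V) : Type _ :=
  ∀ e : {e // v ∈ G.verts e}, ι e.1 ⟨v, e.2⟩

/-- The entanglement structure `φ_G = ⨂ e, φ e`, with the tensor factors grouped along the
vertices: the coefficient of a product basis vector is the product over the edges `e` of the
coefficients of `φ e`. -/
def entanglementStructure [Finite V] [Fintype E] {ι : ∀ e, G.verts e → Type*}
    [∀ e v, Finite (ι e v)] (φ : ∀ e, PartyState (ι e)) : PartyState (G.VertexIndex ι) :=
  PartyState.coords.symm fun x =>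
    ∏ e, PartyState.coords (φ e) fun v : G.verts e => x v ⟨e, v.2⟩

/-- The entanglement structure with a W state on each edge. -/
def wStructure [Finite V] [Fintype E] : PartyState (G.VertexIndex fun _ _ => Fin 2) :=
  G.entanglementStructure fun e => wState (G.verts e)

/-- The entanglement structure with a level-`r` GHZ state on each edge. -/
def ghzStructure [Finite V] [Fintype E] (r : ℕ) :
    PartyState (G.VertexIndex fun _ _ => Fin r) :=
  G.entanglementStructure fun e => ghzState (G.verts e) r

end MultiHypergraph

end

namespace PartyState

variable {P : Type*} [Fintype P] {ι κ : P → Type*}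

theorem coords_tprod [∀ p, Finite (ι p)] (f : ∀ p, ι p → ℂ) (x : ∀ p, ι p) :
    coords (⨂ₜ[ℂ] p, f p) x = ∏ p, f p (x p) := by
  simp [coords, Basis.piTensorProduct_repr_tprod_apply]

/-- The product functional `⨂ p, g p` on states. -/
noncomputable def contract (g : ∀ p, (ι p → ℂ) →ₗ[ℂ] ℂ) : PartyState ι →ₗ[ℂ] ℂ :=
  PiTensorProduct.lift ((MultilinearMap.mkPiAlgebra ℂ P ℂ).compLinearMap g)

theorem contract_map (M : ∀ p, (ι p → ℂ) →ₗ[ℂ] (κ p → ℂ)) (g : ∀ p, (κ p → ℂ) →ₗ[ℂ] ℂ)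
    (φ : PartyState ι) :
    contract g (PiTensorProduct.map M φ) = contract (fun p => g p ∘ₗ M p) φ :=
  LinearMap.congr_fun
    (PiTensorProduct.lift_comp_map M ((MultilinearMap.mkPiAlgebra ℂ P ℂ).compLinearMap g)) φ

variable [∀ p, Fintype (ι p)]

theorem contract_eq_sum [DecidableEq P] [∀ p, DecidableEq (ι p)] (g : ∀ p, (ι p → ℂ) →ₗ[ℂ] ℂ)
    (φ : PartyState ι) :
    contract g φ = ∑ x, coords φ x * ∏ p, g p (Pi.single (x p) 1) := by
  induction φ using PiTensorProduct.induction_on with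
  | smul_tprod r f =>
    have h : ∀ p, g p (f p) = ∑ i, f p i * g p (Pi.single i 1) := fun p => by
      conv_lhs => rw [pi_eq_sum_univ' (f p)]
      simp [map_sum]
    simp only [map_smul, Pi.smul_apply, smul_eq_mul, coords_tprod, mul_assoc,
      ← Finset.prod_mul_distrib]
    rw [← Finset.mul_sum]
    congr 1
    rw [contract, PiTensorProduct.lift.tprod,
      ← Fintype.prod_sum (fun p i => f p i * g p (Pi.single i 1))]
    simp [h]
  | add φ ψ hφ hψ => simp [map_add, hφ, hψ, add_mul, Finset.sum_add_distrib]

theorem coords_eq_contract (φ : PartyState ι) (x : ∀ p, ι p) :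
    coords φ x = contract (fun p => LinearMap.proj (x p)) φ := by
  classical
  rw [contract_eq_sum, Finset.sum_eq_single x]
  · simp
  · intro y _ hy
    obtain ⟨p, hp⟩ := Function.ne_iff.mp hy
    rw [Finset.prod_eq_zero (Finset.mem_univ p), mul_zero]
    simp [hp.symm]
  · simp

theorem coords_map [DecidableEq P] [∀ p, Fintype (κ p)] [∀ p, DecidableEq (ι p)]
    (M : ∀ p, (ι p → ℂ) →ₗ[ℂ] (κ p → ℂ))
    (φ : PartyState ι) (z : ∀ p, κ p) :
    coords (PiTensorProduct.map M φ) z =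
      ∑ x, coords φ x * ∏ p, M p (Pi.single (x p) 1) (z p) := by
  rw [coords_eq_contract, contract_map, contract_eq_sum]
  rfl

theorem coords_power (φ : PartyState ι) (n : ℕ) (x : ∀ p, Fin n → ι p) :
    coords (φ.power n) x = ∏ a, coords φ fun p => x p a := by
  simp [power]

end PartyState

open PartyState

section

variable {P : Type*} [Fintype P] {ι κ : P → Type*} [∀ p, Fintype (ι p)] [∀ p, Fintype (κ p)]

theorem Restricts.power {φ : PartyState ι} {ψ : PartyState κ} (h : Restricts φ ψ) (n : ℕ) :
    Restricts (φ.power n) (ψ.power n) := by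
  classical
  obtain ⟨M, rfl⟩ := h
  refine ⟨fun p => Fintype.linearCombination ℂ
    fun (x : Fin n → ι p) (z : Fin n → κ p) => ∏ a, M p (Pi.single (x a) 1) (z a), ?_⟩
  apply coords.injective
  ext z
  rw [coords_map, coords_power]
  simp only [coords_power, coords_map, Fintype.linearCombination_apply_single, one_smul]
  rw [Fintype.prod_sum]
  refine Fintype.sum_equiv (Equiv.piComm _) _ _ fun x => ?_
  rw [Finset.prod_comm, ← Finset.prod_mul_distrib]
  rfl

theorem Restricts.asymptoticallyRestricts {φ : PartyState ι} {ψ : PartyState κ}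
    (h : Restricts φ ψ) : AsymptoticallyRestricts φ ψ :=
  ⟨fun _ => 0, by simp, fun n => h.power n⟩

/-- Gaussian elimination: outside a set `T` with at most as many elements as `S`, every basis
vector is the lowest one seen by some functional vanishing on the image of `S`. -/
theorem exists_card_le_forall_notMem_exists_functional {α β : Type*} [Fintype β]
    [DecidableEq α] [DecidableEq β] (M : (α → ℂ) →ₗ[ℂ] (β → ℂ)) (S : Finset α) (w : β → ℤ) :
    ∃ T : Finset β, T.card ≤ S.card ∧ ∀ z ∉ T, ∃ g : (β → ℂ) →ₗ[ℂ] ℂ,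
      (∀ y ∈ S, g (M (Pi.single y 1)) = 0) ∧ g (Pi.single z 1) ≠ 0 ∧
        ∀ z', w z' < w z → g (Pi.single z' 1) = 0 := by
  classical
  let ev : Module.Dual ℂ (β → ℂ) →ₗ[ℂ] (S → ℂ) :=
    LinearMap.pi fun y => Module.Dual.eval ℂ (β → ℂ) (M (Pi.single y.1 1))
  let Z : Finset β := {z | ∃ g ∈ LinearMap.ker ev, g (Pi.single z 1) ≠ 0 ∧
    ∀ z', w z' < w z → g (Pi.single z' 1) = 0}
  refine ⟨Zᶜ, ?_, fun z hz => ?_⟩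
  · let res : LinearMap.ker ev →ₗ[ℂ] (Z → ℂ) :=
      (LinearMap.pi fun z => Module.Dual.eval ℂ (β → ℂ) (Pi.single z.1 1)) ∘ₗ
        (LinearMap.ker ev).subtype
    have hres : Function.Injective res := by
      rw [← LinearMap.ker_eq_bot, LinearMap.ker_eq_bot']
      rintro ⟨g, hg⟩ h0
      by_contra hne
      have hex : (Finset.univ.filter fun z => g (Pi.single z 1) ≠ 0).Nonempty := by
        by_contra hemp
        rw [Finset.not_nonempty_iff_eq_empty, Finset.filter_eq_empty_iff] at hemp
        apply hne
        ext z
        simpa using hemp (Finset.mem_univ z)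
      obtain ⟨z, hz, hmin⟩ := Finset.exists_min_image _ w hex
      rw [Finset.mem_filter] at hz
      have hzZ : z ∈ Z := by
        refine Finset.mem_filter.mpr ⟨Finset.mem_univ _, g, hg, hz.2, fun z' hz' => ?_⟩
        by_contra hc
        exact absurd (hmin z' (by simpa using hc)) (not_le.mpr hz')
      exact hz.2 (congr_fun h0 ⟨z, hzZ⟩)
    have h1 := LinearMap.finrank_le_finrank_of_injective hres
    have h2 := ev.finrank_range_add_finrank_ker
    have h3 := Submodule.finrank_le (LinearMap.range ev)
    rw [Subspace.dual_finrank_eq] at h2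
    simp only [Module.finrank_fintype_fun_eq_card, Fintype.card_coe] at h1 h2 h3
    rw [Finset.card_compl]
    omega
  · obtain ⟨g, hg, h⟩ := (Finset.mem_filter.mp (by simpa using hz : z ∈ Z)).2
    exact ⟨g, fun y hy => congr_fun hg ⟨y, hy⟩, h⟩

/-- Covers of the support of a state transfer to restrictions of it with a tight support. -/
theorem Restricts.exists_cover {φ : PartyState ι} {ψ : PartyState κ} (h : Restricts φ ψ)
    (S : ∀ p, Finset (ι p)) (hS : ∀ x, coords φ x ≠ 0 → ∃ p, x p ∈ S p)
    (w : ∀ p, κ p → ℤ) (hw : ∀ p, Function.Injective (w p))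
    (hw0 : ∀ z, coords ψ z ≠ 0 → ∑ p, w p (z p) = 0) :
    ∃ T : ∀ p, Finset (κ p), (∀ p, (T p).card ≤ (S p).card) ∧
      ∀ z, coords ψ z ≠ 0 → ∃ p, z p ∈ T p := by
  classical
  obtain ⟨M, rfl⟩ := h
  choose T hT hg using fun p =>
    exists_card_le_forall_notMem_exists_functional (M p) (S p) (w p)
  refine ⟨T, hT, fun z hz => ?_⟩
  by_contra! hzT
  choose g hgS hgz hgw using fun p => hg p (z p) (hzT p)
  have h0 : contract g (PiTensorProduct.map M φ) = 0 := by
    rw [contract_map, contract_eq_sum]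
    refine Finset.sum_eq_zero fun x _ => ?_
    by_cases hx : coords φ x = 0
    · simp [hx]
    · obtain ⟨p, hp⟩ := hS x hx
      rw [Finset.prod_eq_zero (Finset.mem_univ p), mul_zero]
      exact hgS p _ hp
  rw [contract_eq_sum, Finset.sum_eq_single z] at h0
  · exact mul_ne_zero hz (Finset.prod_ne_zero_iff.mpr fun p _ => hgz p) h0
  · intro y _ hy
    by_cases hy0 : coords (PiTensorProduct.map M φ) y = 0
    · simp [hy0]
    obtain ⟨p, hp⟩ : ∃ p, w p (y p) < w p (z p) := by
      by_contra! hle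
      refine hy (funext fun p => hw p ?_)
      have := (Finset.sum_eq_sum_iff_of_le fun p _ => hle p).mp ((hw0 z hz).trans (hw0 y hy0).symm)
      exact (this p (Finset.mem_univ p)).symm
    rw [Finset.prod_eq_zero (Finset.mem_univ p) (hgw p _ hp), mul_zero]
  · simp

end

theorem ket_apply {κ : Type*} [DecidableEq κ] (i j : κ) : ket i j = if j = i then 1 else 0 := by
  simp only [ket, Pi.single, Function.update_apply, Pi.zero_apply]

section

variable {P : Type*} [Fintype P]

theorem coords_ghzState_ne_zero_iff {r : ℕ} (z : P → Fin r) :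
    coords (ghzState P r) z ≠ 0 ↔ ∃ i, ∀ p, z p = i := by
  classical
  have h : coords (ghzState P r) z = ∑ i : Fin r, if ∀ p, z p = i then 1 else 0 := by
    rw [ghzState, map_sum, Finset.sum_apply]
    refine Finset.sum_congr rfl fun i _ => ?_
    rw [coords_tprod]
    simp only [ket_apply, Finset.prod_boole, Finset.mem_univ, true_implies]
  rw [h, Finset.sum_boole, Nat.cast_ne_zero, Finset.card_ne_zero]
  simp [Finset.Nonempty]

theorem exists_of_coords_wState_ne_zero [DecidableEq P] {z : P → Fin 2}
    (hz : coords (wState P) z ≠ 0) : ∃ q, ∀ p, z p = if p = q then 1 else 0 := by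
  rw [wState, map_sum, Finset.sum_apply] at hz
  obtain ⟨q, -, hq⟩ := Finset.exists_ne_zero_of_sum_ne_zero hz
  rw [coords_tprod, Finset.prod_ne_zero_iff] at hq
  refine ⟨q, fun p => ?_⟩
  have := hq p (Finset.mem_univ p)
  rw [ket_apply, ite_ne_right_iff] at this
  convert this.1

end

theorem eq_zero_of_sum_mul_three_pow_eq_zero {J : Type*} [Fintype J] {k : J → ℕ}
    (hk : Function.Injective k) {d : J → ℤ} (hd : ∀ j, 3 ∣ d j → d j = 0)
    (h : ∑ j, d j * 3 ^ k j = 0) (j : J) : d j = 0 := by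
  classical
  by_contra hj
  obtain ⟨i, hi, hmin⟩ := Finset.exists_min_image (Finset.univ.filter fun j => d j ≠ 0) k
    ⟨j, by simpa using hj⟩
  rw [Finset.mem_filter] at hi
  apply hi.2
  apply hd
  have hdvd : (3 : ℤ) ^ (k i + 1) ∣ ∑ j ∈ Finset.univ.erase i, d j * 3 ^ k j := by
    refine Finset.dvd_sum fun l hl => ?_
    by_cases h0 : d l = 0
    · simp [h0]
    · have h1 := hmin l (by simpa using h0)
      have h2 := hk.ne (Finset.ne_of_mem_erase hl)
      exact (pow_dvd_pow 3 (by omega)).mul_left _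
  rw [← Finset.add_sum_erase _ _ (Finset.mem_univ i)] at h
  have h3 : (3 : ℤ) ^ (k i + 1) ∣ d i * 3 ^ k i := by
    rw [eq_neg_of_add_eq_zero_left h]
    exact hdvd.neg_right
  rw [pow_succ'] at h3
  exact Int.dvd_of_mul_dvd_mul_right (by positivity) h3

theorem card_filter_mem_mul_card {X K R : Type*} [Fintype X] [Fintype K] [Fintype R]
    [DecidableEq K] (e : X ≃ K × R) (T : Finset K) :
    (Finset.univ.filter fun x => (e x).1 ∈ T).card * Fintype.card K =
      T.card * Fintype.card X := by
  have h : (Finset.univ.filter fun x => (e x).1 ∈ T) =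
      (T ×ˢ (Finset.univ : Finset R)).map e.symm.toEmbedding := by
    ext x
    simp [Finset.mem_map_equiv]
  rw [h, Finset.card_map, Finset.card_product, Fintype.card_congr e, Fintype.card_prod,
    Finset.card_univ]
  ring

namespace MultiHypergraph

variable {V E : Type*} (G : MultiHypergraph V E) [Fintype V] [Fintype E]
  [DecidableEq V]

@[to_additive]
theorem prod_prod_incident {M : Type*} [CommMonoid M] (F : ∀ v e, v ∈ G.verts e → M) :
    ∏ v, ∏ e : {e // v ∈ G.verts e}, F v e.1 e.2 = ∏ e, ∏ v : G.verts e, F v.1 e v.2 := by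
  rw [← Fintype.prod_sigma', ← Fintype.prod_sigma']
  exact Fintype.prod_equiv
    ⟨fun x => ⟨x.2.1, x.1, x.2.2⟩, fun x => ⟨x.2.1, x.1, x.2.2⟩, fun _ => rfl, fun _ => rfl⟩
    _ _ fun _ => rfl

variable [DecidableEq E]

theorem coords_power_ghzStructure_ne_zero_iff {r n : ℕ}
    (z : ∀ v, Fin n → G.VertexIndex (fun _ _ => Fin r) v) :
    coords ((G.ghzStructure r).power n) z ≠ 0 ↔
      ∃ x : Fin n → E → Fin r, ∀ v a e, z v a e = x a e.1 := by
  simp only [coords_power, Finset.prod_ne_zero_iff, ghzStructure, entanglementStructure,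
    LinearEquiv.apply_symm_apply, coords_ghzState_ne_zero_iff, Finset.mem_univ, true_implies]
  constructor
  · intro h
    choose x hx using h
    exact ⟨x, fun v a e => hx a e.1 ⟨v, e.2⟩⟩
  · rintro ⟨x, hx⟩ a e
    exact ⟨x a e, fun v => hx _ _ _⟩

theorem exists_of_coords_power_wStructure_ne_zero {n : ℕ}
    {z : ∀ v, Fin n → G.VertexIndex (fun _ _ => Fin 2) v}
    (hz : coords ((G.wStructure).power n) z ≠ 0) (a : Fin n) (e : E) :
    ∃ q : G.verts e, ∀ v : G.verts e, z v a ⟨e, v.2⟩ = if v = q then 1 else 0 := by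
  simp only [coords_power, Finset.prod_ne_zero_iff, wStructure, entanglementStructure,
    LinearEquiv.apply_symm_apply, Finset.mem_univ, true_implies] at hz
  exact exists_of_coords_wState_ne_zero (hz a e)

variable {G}

/-- The support of a power of a GHZ structure on a 3-uniform hypergraph is tight. -/
theorem IsUniform.exists_weight (hG : G.IsUniform 3) (n : ℕ) :
    ∃ w : ∀ v, (Fin n → G.VertexIndex (fun _ _ => Fin 2) v) → ℤ,
      (∀ v, Function.Injective (w v)) ∧
        ∀ z, coords ((G.ghzStructure 2).power n) z ≠ 0 → ∑ v, w v (z v) = 0 := by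
  have hq : ∀ e, (G.verts e).Nonempty := fun e => by
    rw [← Finset.card_pos, hG e]
    norm_num
  choose q hq using hq
  let k : Fin n × E → ℕ := fun j => Fintype.equivFin (Fin n × E) j
  have hk : Function.Injective k := Fin.val_injective.comp (Equiv.injective _)
  let c : V → E → ℤ := fun v e => if v = q e then -2 else 1
  refine ⟨fun v y => ∑ a, ∑ e, c v e.1 * (y a e : ℕ) * 3 ^ k (a, e.1), fun v y y' h => ?_,
    fun z hz => ?_⟩
  · have h0 := eq_zero_of_sum_mul_three_pow_eq_zero
      (k := fun j : Fin n × {e // v ∈ G.verts e} => k (j.1, j.2.1))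
      (d := fun j => c v j.2.1 * ((y j.1 j.2 : ℕ) - (y' j.1 j.2 : ℕ)))
      (fun i j hij => by
        have := hk hij
        simp only [Prod.mk.injEq] at this
        exact Prod.ext this.1 (Subtype.ext this.2))
      (fun j hj => by
        have h1 := (y j.1 j.2).isLt
        have h2 := (y' j.1 j.2).isLt
        simp only [c] at hj ⊢
        split_ifs at hj ⊢ <;> omega)
      (by
        rw [Fintype.sum_prod_type, ← sub_eq_zero.mpr h]
        simp only [← Finset.sum_sub_distrib]
        exact Finset.sum_congr rfl fun a _ => Finset.sum_congr rfl fun e _ => by ring)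
    funext a e
    have h1 := h0 (a, e)
    have hc : c v e.1 ≠ 0 := by
      simp only [c]
      split_ifs <;> norm_num
    have h2 := (mul_eq_zero.mp h1).resolve_left hc
    exact Fin.ext (by simpa using sub_eq_zero.mp h2)
  · obtain ⟨x, hx⟩ := (G.coords_power_ghzStructure_ne_zero_iff z).mp hz
    rw [Finset.sum_comm]
    refine Finset.sum_eq_zero fun a _ => ?_
    simp only [hx]
    rw [G.sum_sum_incident fun v e _ => c v e * (x a e : ℕ) * 3 ^ k (a, e)]
    refine Finset.sum_eq_zero fun e _ => ?_
    rw [← Finset.sum_mul, ← Finset.sum_mul]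
    have hc : ∑ v : G.verts e, c v.1 e = 0 := by
      rw [Finset.sum_coe_sort (G.verts e) fun v => c v e]
      have : ∀ v, c v e = 1 - 3 * if v = q e then 1 else 0 := fun v => by
        simp only [c]
        split_ifs <;> norm_num
      simp [this, hq e, hG e]
    rw [hc, zero_mul, zero_mul]

/-- Powers of a W structure on a 3-uniform hypergraph are covered by sets whose sizes are bounded
by any positive `τ` with `(27 / 4) ^ (n * |E|) < ∏ v, τ v`. -/
theorem IsUniform.exists_cover_wStructure (hG : G.IsUniform 3) (n : ℕ) {τ : V → ℝ}
    (hτ : ∀ v, 0 < τ v) (h : (27 / 4 : ℝ) ^ (n * Fintype.card E) < ∏ v, τ v) :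
    ∃ S : ∀ v, Finset (Fin n → G.VertexIndex (fun _ _ => Fin 2) v),
      (∀ v, ((S v).card : ℝ) ≤ τ v) ∧
        ∀ z, coords ((G.wStructure).power n) z ≠ 0 → ∃ v, z v ∈ S v := by
  classical
  let m : Fin 2 → ℝ := fun i => if i = 1 then 1 / 3 else 2 / 3
  let μ : ∀ v, (Fin n → G.VertexIndex (fun _ _ => Fin 2) v) → ℝ := fun v y => ∏ a, ∏ e, m (y a e)
  have hm : ∀ i, 0 < m i := fun i => by
    simp only [m]
    split_ifs <;> norm_num
  have hμ : ∀ v y, 0 < μ v y := fun v y =>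
    Finset.prod_pos fun a _ => Finset.prod_pos fun e _ => hm _
  have hμ1 : ∀ v, ∑ y, μ v y = 1 := fun v => by
    have h1 : ∑ y : G.VertexIndex (fun _ _ => Fin 2) v, ∏ e, m (y e) = 1 := by
      rw [← Fintype.prod_sum (fun _ i => m i)]
      refine Finset.prod_eq_one fun e _ => ?_
      norm_num [m, Fin.sum_univ_two]
    simp only [μ]
    rw [← Fintype.prod_sum
      (fun (_ : Fin n) (y : G.VertexIndex (fun _ _ => Fin 2) v) => ∏ e, m (y e))]
    simp [h1]
  refine ⟨fun v => {y | (τ v)⁻¹ ≤ μ v y}, fun v => ?_, fun z hz => ?_⟩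
  · rw [← inv_mul_le_one₀ (hτ v), ← hμ1 v, mul_comm, ← nsmul_eq_mul]
    refine (Finset.card_nsmul_le_sum _ (μ v) _ fun y hy => (Finset.mem_filter.mp hy).2).trans ?_
    exact Finset.sum_le_univ_sum_of_nonneg fun y => (hμ v y).le
  · by_contra! hcon
    have hlt : ∀ v, μ v (z v) ≤ (τ v)⁻¹ := fun v => by
      simpa using (le_of_lt (by simpa using hcon v))
    have hprod : ∏ v, μ v (z v) = (4 / 27 : ℝ) ^ (n * Fintype.card E) := by
      simp only [μ]
      rw [Finset.prod_comm]
      have h1 : ∀ a, ∏ v, ∏ e : {e // v ∈ G.verts e}, m (z v a e) =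
          (4 / 27 : ℝ) ^ Fintype.card E := fun a => by
        rw [G.prod_prod_incident fun v e he => m (z v a ⟨e, he⟩), ← Finset.card_univ]
        refine Finset.prod_eq_pow_card fun e _ => ?_
        obtain ⟨q, hq⟩ := G.exists_of_coords_power_wStructure_ne_zero hz a e
        have h2 : ∀ v : G.verts e, m (z v a ⟨e, v.2⟩) = if v = q then 1 / 3 else 2 / 3 :=
          fun v => by
            rw [hq v]
            simp only [m]
            split_ifs <;> simp_all
        rw [Finset.prod_congr rfl fun v _ => h2 v, ← Finset.mul_prod_erase _ _ (Finset.mem_univ q),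
          Finset.prod_congr rfl fun v hv => if_neg (Finset.ne_of_mem_erase hv)]
        simp [Finset.card_erase_of_mem, hG e]
        norm_num
      rw [Finset.prod_congr rfl fun a _ => h1 a]
      simp [← pow_mul, mul_comm]
    have h2 : ∏ v, μ v (z v) ≤ ∏ v, (τ v)⁻¹ :=
      Finset.prod_le_prod (fun v _ => (hμ v _).le) fun v _ => hlt v
    rw [hprod, Finset.prod_inv_distrib, show (4 / 27 : ℝ) = (27 / 4)⁻¹ by norm_num, inv_pow,
      inv_le_inv₀ (by positivity) (Finset.prod_pos fun v _ => hτ v)] at h2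
    exact absurd h (not_lt.mpr h2)

/-- Vertex sets covering the support of a power of a GHZ structure cannot all be small. -/
theorem exists_lt_card_of_cover_ghzStructure (n : ℕ)
    (T : ∀ v, Finset (Fin n → G.VertexIndex (fun _ _ => Fin 2) v))
    (hT : ∀ z, coords ((G.ghzStructure 2).power n) z ≠ 0 → ∃ v, z v ∈ T v) :
    ∃ v, (Fintype.card (Fin n → G.VertexIndex (fun _ _ => Fin 2) v) : ℝ) / (Fintype.card V + 1) <
      (T v).card := by
  by_contra! hle
  let eqv : ∀ v, (Fin n → E → Fin 2) ≃
      (Fin n → G.VertexIndex (fun _ _ => Fin 2) v) × (Fin n → {e // v ∉ G.verts e} → Fin 2) :=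
    fun v => (Equiv.arrowCongr (Equiv.refl _)
      (Equiv.piEquivPiSubtypeProd (fun e => v ∈ G.verts e) fun _ => Fin 2)).trans
      (Equiv.arrowProdEquivProdArrow _ _ _)
  let B : V → Finset (Fin n → E → Fin 2) := fun v => {x | (eqv v x).1 ∈ T v}
  have hcov : (Finset.univ : Finset (Fin n → E → Fin 2)) ⊆ Finset.univ.biUnion B := by
    intro x _
    obtain ⟨v, hv⟩ := hT (fun v => (eqv v x).1)
      ((G.coords_power_ghzStructure_ne_zero_iff _).mpr ⟨x, fun _ _ _ => rfl⟩)
    exact Finset.mem_biUnion.mpr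
      ⟨v, Finset.mem_univ v, Finset.mem_filter.mpr ⟨Finset.mem_univ x, hv⟩⟩
  have h1 := (Finset.card_le_card hcov).trans Finset.card_biUnion_le
  have hB : ∀ v, ((B v).card : ℝ) ≤
      Fintype.card (Fin n → E → Fin 2) / (Fintype.card V + 1) := fun v => by
    have h2 := card_filter_mem_mul_card (eqv v) (T v)
    have hK : (0 : ℝ) < Fintype.card (Fin n → G.VertexIndex (fun _ _ => Fin 2) v) := by
      exact_mod_cast Fintype.card_pos
    refine le_of_mul_le_mul_right ?_ hK
    calc ((B v).card : ℝ) * Fintype.card (Fin n → G.VertexIndex (fun _ _ => Fin 2) v)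
        = (T v).card * Fintype.card (Fin n → E → Fin 2) := by exact_mod_cast h2
      _ ≤ _ := mul_le_mul_of_nonneg_right (hle v) (Nat.cast_nonneg _)
      _ = _ := by ring
  have hX : (0 : ℝ) < Fintype.card (Fin n → E → Fin 2) := by exact_mod_cast Fintype.card_pos
  have h3 : (Fintype.card (Fin n → E → Fin 2) : ℝ) ≤ ∑ v, ((B v).card : ℝ) := by
    rw [Finset.card_univ] at h1
    exact_mod_cast h1
  have h4 := h3.trans (Finset.sum_le_sum fun v _ => hB v)
  rw [Finset.sum_const, Finset.card_univ, nsmul_eq_mul, mul_div_assoc', le_div_iff₀ (by positivity)]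
    at h4
  linarith

theorem IsUniform.prod_card (hG : G.IsUniform 3) (n : ℕ) :
    ∏ v, (Fintype.card (Fin n → G.VertexIndex (fun _ _ => Fin 2) v) : ℝ) =
      8 ^ (n * Fintype.card E) := by
  have h : ∀ v, (Fintype.card (Fin n → G.VertexIndex (fun _ _ => Fin 2) v) : ℝ) =
      (∏ _e : {e // v ∈ G.verts e}, 2) ^ n := fun v => by simp
  rw [Finset.prod_congr rfl fun v _ => h v, Finset.prod_pow,
    G.prod_prod_incident fun _ _ _ => (2 : ℝ)]
  have h2 : ∀ e, ∏ _v : G.verts e, (2 : ℝ) = 8 := fun e => by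
    simp [hG e]
    norm_num
  rw [Finset.prod_congr rfl fun e _ => h2 e, Finset.prod_const, Finset.card_univ, ← pow_mul,
    mul_comm]

theorem IsUniform.pow_le_of_restricts_power (hG : G.IsUniform 3) {N n : ℕ}
    (h : Restricts (G.wStructure.power N) ((G.ghzStructure 2).power n)) :
    (8 : ℝ) ^ (n * Fintype.card E) ≤
      (Fintype.card V + 1 : ℝ) ^ Fintype.card V * (27 / 4) ^ (N * Fintype.card E) := by
  by_contra! hlt
  obtain ⟨S, hS, hcov⟩ := hG.exists_cover_wStructure N
    (τ := fun v => Fintype.card (Fin n → G.VertexIndex (fun _ _ => Fin 2) v) / (Fintype.card V + 1))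
    (fun v => div_pos (by exact_mod_cast Fintype.card_pos) (by positivity))
    (by
      rw [Finset.prod_div_distrib, hG.prod_card, Finset.prod_const, Finset.card_univ,
        lt_div_iff₀ (by positivity)]
      linarith)
  obtain ⟨w, hw, hw0⟩ := hG.exists_weight n
  obtain ⟨T, hTS, hT⟩ := h.exists_cover S hcov w hw hw0
  obtain ⟨v, hv⟩ := exists_lt_card_of_cover_ghzStructure n T hT
  exact absurd (hv.trans_le (Nat.cast_le.mpr (hTS v))) (not_lt.mpr (hS v))

theorem IsUniform.not_asymptoticallyRestricts [Nonempty E] (hG : G.IsUniform 3) :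
    ¬ AsymptoticallyRestricts G.wStructure (G.ghzStructure 2) := by
  rintro ⟨f, hf, h⟩
  set C : ℝ := (Fintype.card V + 1 : ℝ) ^ Fintype.card V
  have hgrow : Tendsto (fun n : ℕ => (8 ^ 12 / (27 / 4) ^ 13 : ℝ) ^ n) atTop atTop :=
    tendsto_pow_atTop_atTop_of_one_lt (by norm_num)
  have hf' := hf.bound (c := 1 / 12) (by norm_num)
  obtain ⟨n, hfn, hn⟩ := (hf'.and (hgrow.eventually_gt_atTop (C ^ 12))).exists
  have hN : 12 * (n + f n) ≤ 13 * n := by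
    simp only [Real.norm_natCast] at hfn
    have : (12 * (n + f n) : ℝ) ≤ 13 * n := by linarith
    exact_mod_cast this
  have hE : 0 < Fintype.card E := Fintype.card_pos
  have h1 := pow_le_pow_left₀ (by positivity) (hG.pow_le_of_restricts_power (h n)) 12
  have h2 : ((27 / 4 : ℝ) ^ ((n + f n) * Fintype.card E)) ^ 12 ≤
      (27 / 4) ^ (13 * (n * Fintype.card E)) := by
    rw [← pow_mul]
    refine pow_le_pow_right₀ (by norm_num) ?_
    calc (n + f n) * Fintype.card E * 12 = 12 * (n + f n) * Fintype.card E := by ring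
      _ ≤ 13 * n * Fintype.card E := Nat.mul_le_mul_right _ hN
      _ = _ := by ring
  rw [mul_pow] at h1
  have h3 : ((8 : ℝ) ^ 12) ^ (n * Fintype.card E) ≤
      C ^ 12 * ((27 / 4) ^ 13) ^ (n * Fintype.card E) := by
    rw [← pow_mul, mul_comm 12, pow_mul, ← pow_mul _ 13]
    exact h1.trans (mul_le_mul_of_nonneg_left h2 (by positivity))
  rw [← div_le_iff₀ (by positivity), ← div_pow] at h3
  have h4 : (8 ^ 12 / (27 / 4) ^ 13 : ℝ) ^ n ≤
      (8 ^ 12 / (27 / 4) ^ 13 : ℝ) ^ (n * Fintype.card E) :=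
    pow_le_pow_right₀ (by norm_num) (Nat.le_mul_of_pos_right n hE)
  exact absurd (hn.trans_le (h4.trans h3)) (lt_irrefl _)

end MultiHypergraph

theorem mainTheorem5 {V E : Type*} [Finite V] [Fintype E] [Nonempty E]
    (G : MultiHypergraph V E) (hG : G.IsUniform 3) :
    ¬ AsymptoticallyRestricts G.wStructure (G.ghzStructure 2) ∧
      ¬ Restricts G.wStructure (G.ghzStructure 2) := by
  classical
  cases nonempty_fintype V
  exact ⟨hG.not_asymptoticallyRestricts,
    fun h => hG.not_asymptoticallyRestricts h.asymptoticallyRestricts⟩
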